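/- Let $K$ be a countable field and let $R\subset K$ be a subring which is a large ideal domain (LID), i.e. $R$ is an infinite countable integral domain such that for every $x\in R\setminus\{0\}$ the ideal $xR$ has finite index in $R$ as an additive subgroup. Let $(F_N)_{N\in\mathbb{N}}$ be a double Følner sequence in $K$, i.e. a sequence of finite subsets of $K$ such that for every $u\in K\setminus\{0\}$ $$\lim_{N\to\infty}\frac{|F_N\cap(F_N+u)|}{|F_N|}=\lim_{N\to\infty}\frac{|F_N\cap(F_Nu)|}{|F_N|}=1,$$ and for $A\subset K$ put $\bar d(A)=\limsup_{N\to\infty}|A\cap F_N|/|F_N|$. Let $E\subset K$ satisfy $\bar d(E)>0$ and let $\varepsilon>0$. Write $E-u=\{x\in K: x+u\in E\}$ and, for $u\neq0$, $E/u=\{x\in K: ux\in E\}$. Then the set $$S=\Big\{u\in R\setminus\{0\}:\ \bar d\big((E-u)\cap(E/u)\big)>\bar d(E)^2-\varepsilon\Big\}$$ is $DC^*$ in $R$ and, moreover, affinely syndetic in $R$. Here $\beta R$ is the compact Hausdorff space of ultrafilters on the discrete set $R$; for $p,q\in\beta R$, the ultrafilters $p+q$ and $pq$ are given by $A\in p+q\iff\{u:\{x:u+x\in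 A\}\in q\}\in p$ and $A\in pq\iff\{u:\{x:ux\in A\}\in q\}\in p$, and $\beta(R\setminus\{0\})$ is the set of $p\in\beta R$ with $R\setminus\{0\}\in p$. Elements of $R$ are identified with principal ultrafilters. Let $\mathcal{AMI}$ be the set of non-principal $p\in\beta R$ with $p+p=p$ that belong to a minimal non-empty compact subset of $\beta R$ invariant under all maps $q\mapsto v+q$, $v\in R$. Let $\mathcal{MMI}$ be the set of non-principal $p\in\beta(R\setminus\{0\})$ with $pp=p$ that belong to a minimal non-empty compact subset of $\beta(R\setminus\{0\})$ invariant under all maps $q\mapsto uq$, $u\in R\setminus\{0\}$. A set $C\subset R$ is $DC$ if $C\in p$ for some $p\in\overline{\mathcal{AMI}}\cap\mathcal{MMI}$, and it is $DC^*$ if it has non-empty intersection with every $DC$ set. A set $S\subset R$ is affinely syndetic in $R$ if there are finitely many maps $g_i:R\to R$, $g_i(x)=u_ix+v_i$ with $u_i\in R\setminus\{0\}$, $v_i\in R$, such that $\bigcup_i g_i^{-1}(S)=R$. -/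

import Mathlib

open Filter Topology

/-! ### Large ideal domains and affine transformations -/

/-- A large ideal domain (LID): an infinite countable integral domain in which every nonzero
principal ideal has finite index as an additive subgroup. -/
structure IsLID (R : Type*) [CommRing R] : Prop where
  infinite : Infinite R
  countable : Countable R
  isDomain : IsDomain R
  finiteIndex : ∀ x : R, x ≠ 0 → (Ideal.span {x}).toAddSubgroup.FiniteIndex

/-- The affine semigroup of `R`: all maps `x ↦ u * x + v` with `u ≠ 0`. -/
def affineSemigroup (R : Type*) [CommRing R] : Set (R → R) :=
  {g | ∃ u v : R, u ≠ 0 ∧ g = fun x => u * x + v}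

/-- `S` is affinely syndetic if finitely many preimages of `S` under affine transformations
cover `R`. -/
def IsAffinelySyndetic {R : Type*} [CommRing R] (S : Set R) : Prop :=
  ∃ F : Set (R → R), F.Finite ∧ F ⊆ affineSemigroup R ∧ ⋃ g ∈ F, g ⁻¹' S = Set.univ

/-! ### Double Følner sequences and upper density -/

/-- A double Følner sequence: finite sets asymptotically invariant under translation by, and
multiplication by, each nonzero element. (The convention `0 / 0 = 0` makes all but finitely many
of the sets nonempty.) -/
def IsDoubleFolner {K : Type*} [Field K] (F : ℕ → Finset K) : Prop :=
  ∀ u : K, u ≠ 0 →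
    Tendsto (fun N => (((F N : Set K) ∩ (fun x => x + u) '' (F N : Set K)).ncard : ℝ)
      / ((F N).card : ℝ)) atTop (𝓝 1) ∧
    Tendsto (fun N => (((F N : Set K) ∩ (fun x => x * u) '' (F N : Set K)).ncard : ℝ)
      / ((F N).card : ℝ)) atTop (𝓝 1)

/-- The upper density of `E` along `F`. -/
noncomputable def folnerUpperDensity {K : Type*} (F : ℕ → Finset K) (E : Set K) : ℝ :=
  limsup (fun N => ((E ∩ (F N : Set K)).ncard : ℝ) / ((F N).card : ℝ)) atTop

/-! ### Minimal idempotent ultrafilters and double central sets -/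

section DoubleCentral

attribute [local instance] Ultrafilter.add Ultrafilter.mul

variable {R : Type*} [CommRing R]

/-- The ultrafilter is not the principal ultrafilter of a point. -/
def IsNonprincipalUltrafilter (p : Ultrafilter R) : Prop :=
  ∀ x : R, p ≠ pure x

/-- Non-empty compact sets of ultrafilters on `R` that are invariant under all the maps
`q ↦ v + q`, `v ∈ R`. -/
def IsAddSubsystem (X : Set (Ultrafilter R)) : Prop :=
  X.Nonempty ∧ IsCompact X ∧ ∀ v : R, ∀ q ∈ X, q.map (fun x => v + x) ∈ X

/-- Non-empty compact sets of ultrafilters on the nonzero elements of `R` (that is, ultrafilters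
on `R` containing `R \ {0}`) that are invariant under all the maps `q ↦ u q`, `u ≠ 0`. -/
def IsMulSubsystem (X : Set (Ultrafilter R)) : Prop :=
  X.Nonempty ∧ IsCompact X ∧ (∀ q ∈ X, ({0}ᶜ : Set R) ∈ q) ∧
    ∀ u : R, u ≠ 0 → ∀ q ∈ X, q.map (fun x => u * x) ∈ X

variable (R) in
/-- The additive minimal idempotents in `βR`. The sum is Mathlib's: `E ∈ p + q` if and only if
`{u | {x | u + x ∈ E} ∈ q} ∈ p`. -/
def addMinimalIdempotents : Set (Ultrafilter R) :=
  {p | IsNonprincipalUltrafilter p ∧ (∃ X, Minimal IsAddSubsystem X ∧ p ∈ X) ∧ p + p = p}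

variable (R) in
/-- The multiplicative minimal idempotents in `β(R \ {0})`. The product is Mathlib's: `E ∈ p * q`
if and only if `{u | {x | u * x ∈ E} ∈ q} ∈ p`. -/
def mulMinimalIdempotents : Set (Ultrafilter R) :=
  {p | IsNonprincipalUltrafilter p ∧ (∃ X, Minimal IsMulSubsystem X ∧ p ∈ X) ∧ p * p = p}

variable (R) in
/-- The multiplicative minimal idempotents that lie in the closure of the additive ones. -/
def doubleCentralUltrafilters : Set (Ultrafilter R) :=
  closure (addMinimalIdempotents R) ∩ mulMinimalIdempotents R

/-- `DC` (double central) sets. -/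
def IsDC (C : Set R) : Prop :=
  ∃ p ∈ doubleCentralUltrafilters R, C ∈ p

/-- `DC*` sets: those that meet every `DC` set. -/
def IsDCStar (C : Set R) : Prop :=
  ∀ D : Set R, IsDC D → (C ∩ D).Nonempty

end DoubleCentral

/-! ### Weak limits along ultrafilters in Hilbert spaces -/

section WeakLimits

variable {ι H : Type*} [NormedAddCommGroup H] [InnerProductSpace ℝ H]

/-! Averages over `F N` along a suitable ultrafilter on `ℕ` give a mean m with m(1_E) equal to the
upper density of E and m at most the upper density on every set. The double Følner property makes m
invariant under translations and nonzero dilations, so these act by isometries A_v, M_u on the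
completion of the bounded functions under m(fg). With e = 1_E, the mean of (E - u) ∩ E/u is ⟨A_u e,
M_u e⟩, which must exceed ⟨e, 1⟩² - ε for p-many u, for every double central p.

Split e = k + f with k almost periodic under translations by R and f orthogonal to all such vectors.
Since p is a limit of additive idempotents, A_u k is close to k for p-many u. Since nonzero ideals
have finite index, M_u⁻¹ preserves almost periodicity, whence ⟨k, M_u e⟩ = ⟨M_u k, k⟩. By pp = p,
M_u k has a weak limit x with ⟨x, k⟩ = ‖x‖² ≥ ⟨x, 1⟩² = ⟨e, 1⟩²
(`Ultrafilter.exists_weak_limit_of_idempotent`). Finally ⟨A_u f, M_u e⟩ → 0 by van der Corput: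
correlating the shifts of M_u⁻¹ A_u f by b and c leaves a translation by (b² - c²)u, and f is weakly
mixing because weak limits along additive minimal idempotents are recurrent, hence almost periodic.

Affine syndeticity is a consequence of DC*: the complement of a set that is not affinely syndetic is
affinely thick, and affinely thick sets are DC (`IsLID.isDC_of_affinely_thick`). -/

theorem Ultrafilter.exists_weak_limit [CompleteSpace H] (p : Ultrafilter ι) (a : ι → H) (C : ℝ)
    (ha : ∀ u, ‖a u‖ ≤ C) :
    ∃ x : H, ∀ h : H, Tendsto (fun u => inner ℝ (a u) h) p (𝓝 (inner ℝ x h)) := by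
  have hc := WeakDual.isCompact_closedBall (𝕜 := ℝ) (E := H) 0 C
  -- Riesz duality moves the family into a weak-* compact ball (Banach–Alaoglu).
  let f : ι → WeakDual ℝ H := fun u =>
    WeakDual.toStrongDual.symm (InnerProductSpace.toDual ℝ H (a u))
  obtain ⟨φ, -, hφ⟩ := hc.ultrafilter_le_nhds (p.map f) (by
    rw [le_principal_iff, Ultrafilter.mem_coe, Ultrafilter.mem_map]
    refine Filter.univ_mem' fun u => ?_
    have hn : ‖InnerProductSpace.toDual ℝ H (a u)‖ ≤ C := by
      rw [LinearIsometryEquiv.norm_map]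
      exact ha u
    simpa [f] using hn)
  refine ⟨(InnerProductSpace.toDual ℝ H).symm (WeakDual.toStrongDual φ), fun h => ?_⟩
  have h1 : Tendsto f p (𝓝 φ) := hφ
  have h2 : Tendsto (fun u => f u h) p (𝓝 (φ h)) :=
    ((WeakDual.eval_continuous h).tendsto φ).comp h1
  rw [InnerProductSpace.toDual_symm_apply]
  simpa [f] using h2

/-- The weak limit along an idempotent ultrafilter of a semigroup of linear isometries is an
orthogonal projection onto vectors that are fixed in the limit. -/
theorem Ultrafilter.exists_weak_limit_of_idempotent [CompleteSpace H] (p : Ultrafilter ι)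
    (op : ι → ι → ι) (hp : ∀ s ∈ p, ∀ᶠ u in (p : Filter ι), ∀ᶠ v in (p : Filter ι), op u v ∈ s)
    (T : ι → H →ₗᵢ[ℝ] H)
    (hT : ∀ᶠ u in (p : Filter ι), ∀ᶠ v in (p : Filter ι), ∀ x, T (op u v) x = T u (T v x)) (k : H) :
    ∃ x : H, (∀ h, Tendsto (fun u => inner ℝ (T u k) h) p (𝓝 (inner ℝ x h))) ∧
      Tendsto (fun u => T u x) p (𝓝 x) ∧ inner ℝ k x = ‖x‖ ^ 2 := by
  obtain ⟨x, hx⟩ := p.exists_weak_limit (fun u => T u k) ‖k‖ fun u => (T u).norm_map k |>.le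
  -- T_u x is the weak limit over v of T_u T_v k = T_{op u v} k, which idempotence keeps near x.
  have key : ∀ h, Tendsto (fun u => inner ℝ (T u x) h) p (𝓝 (inner ℝ x h)) := by
    intro h
    rw [Metric.tendsto_nhds]
    intro ε hε
    have h1 := hp {u | dist (inner ℝ (T u k) h) (inner ℝ x h) < ε / 2}
      (Metric.tendsto_nhds.1 (hx h) _ (half_pos hε))
    filter_upwards [h1, hT] with u hu hu'
    have h2 : Tendsto (fun v => inner ℝ (T u (T v k)) h) p (𝓝 (inner ℝ (T u x) h)) := by
      have h3 := hx ((T u).toContinuousLinearMap.adjoint h)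
      simpa [ContinuousLinearMap.adjoint_inner_right] using h3
    have h3 : dist (inner ℝ (T u x) h) (inner ℝ x h) ≤ ε / 2 := by
      refine le_of_tendsto (h2.dist tendsto_const_nhds) ?_
      filter_upwards [hu, hu'] with v hv hv'
      rw [← hv']
      exact hv.le
    linarith
  -- Weak convergence with constant norms is strong convergence.
  have hfix : Tendsto (fun u => T u x) p (𝓝 x) := by
    rw [tendsto_iff_norm_sub_tendsto_zero]
    have h1 : Tendsto (fun u => ‖T u x - x‖ ^ 2) p (𝓝 0) := by
      have h2 : ∀ u, ‖T u x - x‖ ^ 2 = 2 * ‖x‖ ^ 2 - 2 * inner ℝ (T u x) x := by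
        intro u
        rw [norm_sub_sq_real, (T u).norm_map]
        ring
      simp only [h2]
      have h3 := ((key x).const_mul 2).const_sub (2 * ‖x‖ ^ 2)
      rwa [real_inner_self_eq_norm_sq, sub_self] at h3
    have h2 := h1.sqrt
    simpa using h2
  refine ⟨x, hx, hfix, ?_⟩
  -- The left side is constantly ⟨T_u k, T_u x⟩ = ⟨k, x⟩, and T_u x → x strongly.
  have h1 : Tendsto (fun u => inner ℝ (T u k) x - inner ℝ (T u k) (x - T u x)) p
      (𝓝 (inner ℝ x x - 0)) := by
    refine (hx x).sub ?_
    have h2 : Tendsto (fun u => ‖k‖ * ‖x - T u x‖) p (𝓝 0) := by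
      have h3 := (hfix.const_sub x).norm.const_mul ‖k‖
      simpa using h3
    refine squeeze_zero_norm (fun u => ?_) h2
    rw [← (T u).norm_map k]
    exact norm_inner_le_norm _ _
  have h2 : ∀ u, inner ℝ (T u k) x - inner ℝ (T u k) (x - T u x) = inner ℝ k x := by
    intro u
    rw [inner_sub_right, (T u).inner_map_map]
    ring
  simp only [h2] at h1
  rw [tendsto_nhds_unique tendsto_const_nhds h1, sub_zero, real_inner_self_eq_norm_sq]

theorem norm_sq_sum_le_of_inner_le {κ : Type*} (s : Finset κ) (w : κ → H) (C δ : ℝ)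
    (hC : ∀ i ∈ s, ‖w i‖ ^ 2 ≤ C) (hδ : 0 ≤ δ)
    (hw : ∀ i ∈ s, ∀ j ∈ s, i ≠ j → inner ℝ (w i) (w j) ≤ δ) :
    ‖∑ i ∈ s, w i‖ ^ 2 ≤ s.card * (C + s.card * δ) := by
  rw [← real_inner_self_eq_norm_sq, sum_inner, ← nsmul_eq_mul]
  refine Finset.sum_le_card_nsmul _ _ _ fun i hi => ?_
  rw [inner_sum]
  classical
  rw [← Finset.add_sum_erase _ _ hi, real_inner_self_eq_norm_sq]
  refine add_le_add (hC i hi) ?_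
  calc ∑ j ∈ s.erase i, inner ℝ (w i) (w j) ≤ ∑ j ∈ s.erase i, δ :=
        Finset.sum_le_sum fun j hj =>
          hw i hi j (Finset.mem_of_mem_erase hj) (Finset.ne_of_mem_erase hj).symm
    _ ≤ ∑ j ∈ s, δ := Finset.sum_le_sum_of_subset_of_nonneg (Finset.erase_subset _ _)
        fun _ _ _ => hδ
    _ = s.card * δ := by simp

/-- A van der Corput lemma along an idempotent ultrafilter: if all large sets contain infinite
families of indices along which the shifts of a bounded sequence become orthogonal, then the
sequence tends weakly to zero. -/
theorem Ultrafilter.tendsto_inner_zero_of_shifts_orthogonal (p : Ultrafilter ι)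
    (op : ι → ι → ι) (hp : ∀ s ∈ p, ∀ᶠ b in (p : Filter ι), ∀ᶠ u in (p : Filter ι), op b u ∈ s)
    (a : ι → H) (C : ℝ) (ha : ∀ u, ‖a u‖ ≤ C)
    (horth : ∀ B ∈ p, ∀ N : ℕ, ∃ s : Finset ι, (s : Set ι) ⊆ B ∧ s.card = N ∧
      ∀ b ∈ s, ∀ c ∈ s, b ≠ c →
        Tendsto (fun u => inner ℝ (a (op b u)) (a (op c u))) p (𝓝 0)) (h : H) :
    Tendsto (fun u => inner ℝ (a u) h) p (𝓝 0) := by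
  have main : ∀ h : H, ∀ c > 0, ¬ ∀ᶠ u in (p : Filter ι), c ≤ inner ℝ (a u) h := by
    intro h c hc hG
    have hC : 0 ≤ C := by
      obtain ⟨u⟩ : Nonempty ι := Filter.nonempty_of_neBot (p : Filter ι)
      exact (norm_nonneg _).trans (ha u)
    -- For N almost orthogonal shifts, the sum has norm² at most N(C² + 1) but pairs with h to at
    -- least Nc; this N makes the two incompatible.
    obtain ⟨N, hN⟩ := exists_nat_gt (‖h‖ ^ 2 * (C ^ 2 + 1) / c ^ 2)
    have hN0 : 0 < (N : ℝ) := lt_of_le_of_lt (by positivity) hN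
    obtain ⟨s, hsB, hcard, hs⟩ := horth _ (hp _ hG) N
    have h1 : ∀ᶠ u in (p : Filter ι), ∀ b ∈ s, c ≤ inner ℝ (a (op b u)) h :=
      (Finset.eventually_all s).2 fun b hb => hsB hb
    have h2 : ∀ᶠ u in (p : Filter ι), ∀ i ∈ s, ∀ j ∈ s, i ≠ j →
        inner ℝ (a (op i u)) (a (op j u)) ≤ 1 / N := by
      refine (Finset.eventually_all s).2 fun i hi => (Finset.eventually_all s).2 fun j hj => ?_
      by_cases hij : i = j
      · exact Eventually.of_forall fun u hne => absurd hij hne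
      · filter_upwards [(hs i hi j hj hij).eventually_lt_const (one_div_pos.2 hN0)] with u hu _
        exact hu.le
    obtain ⟨u, hu1, hu2⟩ := (h1.and h2).exists
    have h3 := norm_sq_sum_le_of_inner_le s (fun b => a (op b u)) (C ^ 2) (1 / N)
      (fun i _ => pow_le_pow_left₀ (norm_nonneg _) (ha _) 2) (by positivity) hu2
    have h4 : N * c ≤ inner ℝ (∑ b ∈ s, a (op b u)) h := by
      rw [sum_inner, ← hcard, ← nsmul_eq_mul]
      exact Finset.card_nsmul_le_sum _ _ _ hu1
    have h5 := h4.trans (real_inner_le_norm _ _)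
    rw [hcard, mul_one_div_cancel hN0.ne'] at h3
    have h6 : (N * c) ^ 2 ≤ N * (C ^ 2 + 1) * ‖h‖ ^ 2 := by
      calc (N * c) ^ 2 ≤ (‖∑ b ∈ s, a (op b u)‖ * ‖h‖) ^ 2 :=
            pow_le_pow_left₀ (by positivity) h5 2
        _ ≤ _ := by rw [mul_pow]; gcongr
    rw [div_lt_iff₀ (by positivity)] at hN
    nlinarith
  rw [Metric.tendsto_nhds]
  intro ε hε
  have h1 := Ultrafilter.eventually_not.2 (main h ε hε)
  have h2 := Ultrafilter.eventually_not.2 (main (-h) ε hε)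
  filter_upwards [h1, h2] with u hu1 hu2
  rw [inner_neg_right] at hu2
  rw [Real.dist_eq, sub_zero, abs_lt]
  constructor <;> linarith

end WeakLimits

/-! ### Dynamics of affine maps on spaces of ultrafilters -/

section UltrafilterDynamics

theorem Ultrafilter.continuous_map {α β : Type*} (f : α → β) :
    Continuous (Ultrafilter.map f) := by
  refine continuous_generateFrom_iff.2 ?_
  rintro _ ⟨s, rfl⟩
  exact ultrafilter_isOpen_basic (f ⁻¹' s)

/-- This carries "for many v" statements from additive minimal idempotents to their limits, which
need not be additive idempotents. -/
theorem Ultrafilter.mem_of_mem_closure {α : Type*} {X : Set (Ultrafilter α)} {p : Ultrafilter α}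
    (hp : p ∈ closure X) {s : Set α} (hs : ∀ q ∈ X, s ∈ q) : s ∈ p :=
  closure_minimal (t := {q : Ultrafilter α | s ∈ q}) hs (ultrafilter_isClosed_basic s) hp

theorem Ultrafilter.mem_closure_image_pure {α : Type*} {p : Ultrafilter α} {s : Set α}
    (hs : s ∈ p) : p ∈ closure ((pure : α → Ultrafilter α) '' s) := by
  rw [ultrafilterBasis_is_basis.mem_closure_iff]
  rintro _ ⟨t, rfl⟩ ht
  obtain ⟨x, hx⟩ := p.nonempty_of_mem (Filter.inter_mem ht hs)
  exact ⟨pure x, hx.1, x, hx.2, rfl⟩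

/-- Minimal elements exist among non-empty compact sets with a property that is stable under
intersections. -/
theorem exists_minimal_nonempty_compact {X : Type*} [TopologicalSpace X] [T2Space X]
    (I : Set X → Prop) (hI : ∀ c : Set (Set X), c.Nonempty → (∀ s ∈ c, I s) → I (⋂₀ c))
    (Y : Set X) (hY : Y.Nonempty ∧ IsCompact Y ∧ I Y) :
    ∃ m ⊆ Y, Minimal (fun s => s.Nonempty ∧ IsCompact s ∧ I s) m := by
  refine zorn_superset_nonempty {s | s.Nonempty ∧ IsCompact s ∧ I s} ?_ Y hY
  intro c hc hchain hne
  have : Nonempty c := hne.to_subtype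
  refine ⟨⋂₀ c, ⟨?_, ?_, hI c hne fun s hs => (hc hs).2.2⟩, fun s hs => Set.sInter_subset_of_mem hs⟩
  · exact IsCompact.nonempty_sInter_of_directed_nonempty_isCompact_isClosed
      (IsChain.directedOn hchain.symm) (fun s hs => (hc hs).1) (fun s hs => (hc hs).2.1)
      fun s hs => (hc hs).2.1.isClosed
  · obtain ⟨s, hs⟩ := hne
    exact (hc hs).2.1.of_isClosed_subset
      (isClosed_sInter fun t ht => (hc ht).2.1.isClosed) (Set.sInter_subset_of_mem hs)

theorem isNonprincipalUltrafilter_iff {R : Type*} {p : Ultrafilter R} :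
    IsNonprincipalUltrafilter p ↔ ∀ x : R, ({x}ᶜ : Set R) ∈ p := by
  refine forall_congr' fun x => ?_
  rw [Ultrafilter.compl_mem_iff_notMem, not_iff_not]
  constructor
  · rintro rfl
    exact Set.mem_singleton x
  · intro h
    obtain ⟨y, hy, hpy⟩ := Ultrafilter.eq_pure_of_finite_mem (Set.finite_singleton x) h
    rw [hpy, Set.mem_singleton_iff.1 hy]

theorem IsNonprincipalUltrafilter.compl_singleton_mem {R : Type*} {p : Ultrafilter R}
    (hp : IsNonprincipalUltrafilter p) (x : R) : ({x}ᶜ : Set R) ∈ p :=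
  isNonprincipalUltrafilter_iff.1 hp x

theorem IsNonprincipalUltrafilter.compl_finite_mem {R : Type*} {p : Ultrafilter R}
    (hp : IsNonprincipalUltrafilter p) {s : Set R} (hs : s.Finite) : sᶜ ∈ p := by
  rw [Ultrafilter.compl_mem_iff_notMem]
  intro h
  obtain ⟨y, -, hpy⟩ := Ultrafilter.eq_pure_of_finite_mem hs h
  exact hp y hpy

theorem IsNonprincipalUltrafilter.map {R : Type*} {p : Ultrafilter R} (hp : IsNonprincipalUltrafilter p)
    {f : R → R} (hf : Function.Injective f) : IsNonprincipalUltrafilter (p.map f) :=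
  isNonprincipalUltrafilter_iff.2 fun x =>
    hp.compl_finite_mem (s := f ⁻¹' {x}) ((Set.finite_singleton x).preimage hf.injOn)

theorem isClosed_setOf_isNonprincipalUltrafilter (R : Type*) :
    IsClosed {p : Ultrafilter R | IsNonprincipalUltrafilter p} := by
  have : {p : Ultrafilter R | IsNonprincipalUltrafilter p} =
      ⋂ x : R, {p : Ultrafilter R | ({x}ᶜ : Set R) ∈ p} := by
    ext p
    rw [Set.mem_iInter]
    exact isNonprincipalUltrafilter_iff
  rw [this]
  exact isClosed_iInter fun x => ultrafilter_isClosed_basic _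

attribute [local instance] Ultrafilter.add Ultrafilter.mul

variable {R : Type*} [CommRing R]

theorem IsAddSubsystem.exists_minimal {X : Set (Ultrafilter R)} (hX : IsAddSubsystem X) :
    ∃ Y ⊆ X, Minimal IsAddSubsystem Y :=
  exists_minimal_nonempty_compact (fun Y => ∀ v : R, ∀ q : Ultrafilter R, q ∈ Y → q.map (fun x => v + x) ∈ Y)
    (fun _ _ hc v q hq s hs => hc s hs v q (hq s hs)) X hX

theorem IsMulSubsystem.exists_minimal {X : Set (Ultrafilter R)} (hX : IsMulSubsystem X) :
    ∃ Y ⊆ X, Minimal IsMulSubsystem Y :=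
  exists_minimal_nonempty_compact (fun Y => (∀ q ∈ Y, ({0}ᶜ : Set R) ∈ q) ∧
      ∀ u : R, u ≠ 0 → ∀ q : Ultrafilter R, q ∈ Y → q.map (fun x => u * x) ∈ Y)
    (fun _ ⟨s₀, hs₀⟩ hc => ⟨fun q hq => (hc s₀ hs₀).1 q (hq s₀ hs₀),
      fun u hu q hq s hs => (hc s hs).2 u hu q (hq s hs)⟩) X hX

theorem Ultrafilter.pure_add (v : R) (q : Ultrafilter R) :
    pure v + q = q.map (fun x => v + x) :=
  Ultrafilter.coe_inj.1 <| Filter.ext' fun _ => Iff.rfl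

theorem Ultrafilter.pure_mul (v : R) (q : Ultrafilter R) :
    pure v * q = q.map (fun x => v * x) :=
  Ultrafilter.coe_inj.1 <| Filter.ext' fun _ => Iff.rfl

/-- Principal ultrafilters are dense and p ↦ p + q is continuous, so invariance under R extends to
all of βR. -/
theorem IsAddSubsystem.add_mem {X : Set (Ultrafilter R)} (hX : IsAddSubsystem X)
    (p : Ultrafilter R) {q : Ultrafilter R} (hq : q ∈ X) : p + q ∈ X := by
  have h := map_mem_closure (Ultrafilter.continuous_add_left q)
    (Ultrafilter.mem_closure_image_pure (p := p) Filter.univ_mem) (t := X) (by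
      rintro _ ⟨v, -, rfl⟩
      simp only [Ultrafilter.pure_add]
      exact hX.2.2 v q hq)
  rwa [hX.2.1.isClosed.closure_eq] at h

theorem IsMulSubsystem.mul_mem {X : Set (Ultrafilter R)} (hX : IsMulSubsystem X)
    {p : Ultrafilter R} (hp : ({0}ᶜ : Set R) ∈ p) {q : Ultrafilter R} (hq : q ∈ X) :
    p * q ∈ X := by
  have h := map_mem_closure (Ultrafilter.continuous_mul_left q)
    (Ultrafilter.mem_closure_image_pure hp) (t := X) (by
      rintro _ ⟨v, hv, rfl⟩
      simp only [Ultrafilter.pure_mul]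
      exact hX.2.2.2 v hv q hq)
  rwa [hX.2.1.isClosed.closure_eq] at h

theorem IsAddSubsystem.exists_idempotent {X : Set (Ultrafilter R)} (hX : IsAddSubsystem X) :
    ∃ q ∈ X, q + q = q :=
  letI : AddSemigroup (Ultrafilter R) := Ultrafilter.addSemigroup
  exists_idempotent_in_compact_add_subsemigroup (Ultrafilter.continuous_add_left (M := R)) X hX.1
    hX.2.1 fun p _ _ hq => hX.add_mem p hq

theorem IsMulSubsystem.exists_idempotent {X : Set (Ultrafilter R)} (hX : IsMulSubsystem X) :
    ∃ q ∈ X, q * q = q :=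
  letI : Semigroup (Ultrafilter R) := Ultrafilter.semigroup
  exists_idempotent_in_compact_subsemigroup (Ultrafilter.continuous_mul_left (M := R)) X hX.1
    hX.2.1 fun p hp _ hq => hX.mul_mem (hX.2.2.1 p hp) hq

variable (R) in
theorem isAddSubsystem_nonprincipal [Infinite R] :
    IsAddSubsystem {p : Ultrafilter R | IsNonprincipalUltrafilter p} := by
  refine ⟨⟨hyperfilter R, ?_⟩, (isClosed_setOf_isNonprincipalUltrafilter R).isCompact,
    fun v q hq => hq.map (add_right_injective v)⟩
  exact isNonprincipalUltrafilter_iff.2 fun x => (Set.finite_singleton x).compl_mem_hyperfilter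

/-- The orbit of a principal ultrafilter is dense, so a minimal system containing one would be all
of βR, which properly contains the nonprincipal subsystem. -/
theorem IsAddSubsystem.isNonprincipal_of_minimal [Infinite R] {X : Set (Ultrafilter R)}
    (hX : Minimal IsAddSubsystem X) {p : Ultrafilter R} (hp : p ∈ X) :
    IsNonprincipalUltrafilter p := by
  rintro x rfl
  have huniv : X = Set.univ := by
    refine Set.eq_univ_of_forall fun q => ?_
    have h := Ultrafilter.mem_closure_image_pure (p := q) Filter.univ_mem
    refine (hX.prop.2.1.isClosed.closure_subset_iff.2 ?_) h
    rintro _ ⟨y, -, rfl⟩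
    have h1 := hX.prop.2.2 (y - x) _ hp
    rwa [Ultrafilter.map_pure, sub_add_cancel] at h1
  exact hX.2 (isAddSubsystem_nonprincipal R) (huniv ▸ Set.subset_univ _) hp x rfl

/-- The difference set of a member of an additive minimal ultrafilter is syndetic. -/
theorem IsAddSubsystem.exists_finset_differences {X : Set (Ultrafilter R)}
    (hX : Minimal IsAddSubsystem X) {q : Ultrafilter R} (hq : q ∈ X) {A : Set R} (hA : A ∈ q) :
    ∃ W : Finset R, ∀ v : R, ∃ w ∈ W, ∃ a ∈ A, ∃ b ∈ A, v + a = w + b := by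
  -- Otherwise the points of X none of whose translates contain A form a subsystem missing q.
  have hcover : X ⊆ ⋃ v : R, {r : Ultrafilter R | (fun x => v + x) ⁻¹' A ∈ r} := by
    by_contra hne
    obtain ⟨r, hr, hrA⟩ := Set.not_subset.1 hne
    simp only [Set.mem_iUnion, Set.mem_ofPred_eq, not_exists] at hrA
    have hY : IsAddSubsystem (X ∩ ⋂ v : R, {r : Ultrafilter R | ((fun x => v + x) ⁻¹' A)ᶜ ∈ r}) := by
      refine ⟨⟨r, hr, ?_⟩, ?_, ?_⟩
      · simp only [Set.mem_iInter, Set.mem_ofPred_eq]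
        exact fun v => Ultrafilter.compl_mem_iff_notMem.2 (hrA v)
      · exact hX.prop.2.1.inter_right (isClosed_iInter fun v => ultrafilter_isClosed_basic _)
      · rintro v s ⟨hs, hs'⟩
        refine ⟨hX.prop.2.2 v s hs, ?_⟩
        simp only [Set.mem_iInter, Set.mem_ofPred_eq] at hs' ⊢
        intro w
        rw [Ultrafilter.mem_map]
        convert hs' (w + v) using 1
        ext x
        simp [add_assoc]
    have h1 := (hX.2 hY Set.inter_subset_left hq).2
    simp only [Set.mem_iInter, Set.mem_ofPred_eq] at h1
    have h2 := h1 0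
    rw [Ultrafilter.compl_mem_iff_notMem] at h2
    exact h2 (by simpa using hA)
  obtain ⟨W, hW⟩ := hX.prop.2.1.elim_finite_subcover _
    (fun v => ultrafilter_isOpen_basic ((fun x => v + x) ⁻¹' A)) hcover
  classical
  -- As v + q lies in X, some w + v + q contains A; hence the representative -w.
  refine ⟨W.image Neg.neg, fun v => ?_⟩
  have h1 := hW (hX.prop.2.2 v q hq)
  simp only [Set.mem_iUnion, Set.mem_ofPred_eq, exists_prop] at h1
  obtain ⟨w, hw, hwA⟩ := h1
  obtain ⟨a, ha, haA⟩ := q.nonempty_of_mem (Filter.inter_mem (Ultrafilter.mem_map.1 hwA) hA)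
  exact ⟨-w, Finset.mem_image_of_mem _ hw, a, haA, w + (v + a), ha, by ring⟩

theorem IsLID.exists_finset_cosets (hR : IsLID R) {c : R} (hc : c ≠ 0) :
    ∃ W : Finset R, ∀ v : R, ∃ w ∈ W, ∃ r : R, v = w + c * r := by
  have := hR.finiteIndex c hc
  let G := (Ideal.span {c}).toAddSubgroup
  have hfin : Finite (R ⧸ G) := AddSubgroup.finite_quotient_of_finiteIndex
  refine ⟨(Set.finite_range (fun x : R ⧸ G => x.out)).toFinset, fun v => ?_⟩
  refine ⟨(QuotientAddGroup.mk v : R ⧸ G).out, by simp, ?_⟩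
  have h1 : -(QuotientAddGroup.mk v : R ⧸ G).out + v ∈ G := by
    rw [← QuotientAddGroup.eq, QuotientAddGroup.out_eq']
  obtain ⟨r, hr⟩ := Ideal.mem_span_singleton.1 h1
  exact ⟨r, by rw [← hr]; ring⟩

/-- In a large ideal domain, dilations map minimal additive systems into minimal ones. -/
theorem IsLID.map_mul_mem_addMinimalIdempotents (hR : IsLID R) {u : R} (hu : u ≠ 0)
    {q : Ultrafilter R} (hq : q ∈ addMinimalIdempotents R) :
    q.map (fun x => u * x) ∈ addMinimalIdempotents R := by
  have := hR.isDomain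
  obtain ⟨hnp, ⟨X, hX, hqX⟩, hidem⟩ := hq
  refine ⟨hnp.map (mul_right_injective₀ hu), ?_, ?_⟩
  · obtain ⟨W, hW⟩ := hR.exists_finset_cosets hu
    let D : Ultrafilter R → Ultrafilter R := Ultrafilter.map (fun x => u * x)
    let t : R → Ultrafilter R → Ultrafilter R := fun v => Ultrafilter.map (fun x => v + x)
    have htt : ∀ v w s, t v (t w s) = t (v + w) s := by
      intro v w s
      simp only [t, Ultrafilter.map_map]
      congr 1
      ext x
      simp [add_assoc]
    have htD : ∀ v s, t (u * v) (D s) = D (t v s) := by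
      intro v s
      simp only [t, D, Ultrafilter.map_map]
      congr 1
      ext x
      simp [mul_add]
    have ht0 : ∀ s, t 0 s = s := by
      intro s
      simp [t, Ultrafilter.map_id']
    -- uX is invariant only under uR; adding finitely many coset translates restores invariance
    -- under R.
    let X' : Set (Ultrafilter R) := ⋃ w ∈ W, (fun s => t w (D s)) '' X
    have hX' : IsAddSubsystem X' := by
      refine ⟨?_, ?_, ?_⟩
      · obtain ⟨w, hw, -⟩ := hW 0
        exact ⟨t w (D q), Set.mem_biUnion hw ⟨q, hqX, rfl⟩⟩
      · exact W.isCompact_biUnion fun w _ => hX.prop.2.1.image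
          ((Ultrafilter.continuous_map _).comp (Ultrafilter.continuous_map _))
      · intro v s hs
        simp only [X', Set.mem_iUnion, exists_prop] at hs ⊢
        obtain ⟨w, hw, s, hs, rfl⟩ := hs
        obtain ⟨w', hw', r, hr⟩ := hW (v + w)
        refine ⟨w', hw', t r s, hX.prop.2.2 r s hs, ?_⟩
        change t w' (D (t r s)) = t v (t w (D s))
        rw [← htD, htt, htt, hr]
    obtain ⟨Z, hZX', hZ⟩ := hX'.exists_minimal
    refine ⟨Z, hZ, ?_⟩
    -- By minimality of X this pullback is all of X, which places uq in the minimal system Z.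
    have hY : IsAddSubsystem (X ∩ D ⁻¹' Z) := by
      refine ⟨?_, ?_, ?_⟩
      · obtain ⟨z, hz⟩ := hZ.prop.1
        have h1 := hZX' hz
        simp only [X', Set.mem_iUnion, exists_prop] at h1
        obtain ⟨w, hw, s, hs, rfl⟩ := h1
        refine ⟨s, hs, ?_⟩
        have h2 : t (-w) (t w (D s)) ∈ Z := hZ.prop.2.2 (-w) _ hz
        rwa [htt, neg_add_cancel, ht0] at h2
      · exact hX.prop.2.1.inter_right
          (hZ.prop.2.1.isClosed.preimage (Ultrafilter.continuous_map _))
      · rintro v s ⟨hs, hsZ⟩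
        refine ⟨hX.prop.2.2 v s hs, ?_⟩
        change D (t v s) ∈ Z
        rw [← htD]
        exact hZ.prop.2.2 _ _ hsZ
    exact (hX.2 hY Set.inter_subset_left hqX).2
  · refine Ultrafilter.coe_inj.1 (Filter.ext' fun P => ?_)
    have h : (∀ᶠ x in ((q + q : Ultrafilter R) : Filter R), P (u * x)) ↔
        ∀ᶠ x in (q : Filter R), P (u * x) := by rw [hidem]
    rw [Ultrafilter.eventually_add] at h
    rw [Ultrafilter.eventually_add]
    simp only [Ultrafilter.coe_map, Filter.eventually_map, ← mul_add]
    exact h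

/-- Every affinely thick set in a large ideal domain is double central. -/
theorem IsLID.isDC_of_affinely_thick (hR : IsLID R) {T : Set R}
    (hT : ∀ G : Finset (R → R), (G : Set (R → R)) ⊆ affineSemigroup R → ∃ x, ∀ g ∈ G, g x ∈ T) :
    IsDC T := by
  have := hR.isDomain
  have := hR.infinite
  let X : Set (Ultrafilter R) := ⋂ g : affineSemigroup R, {q | (g : R → R) ⁻¹' T ∈ q}
  have hXne : X.Nonempty := by
    refine CompactSpace.iInter_nonempty (fun g => ultrafilter_isClosed_basic _) fun G => ?_
    classical
    obtain ⟨x, hx⟩ := hT (G.image Subtype.val) (by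
      intro g hg
      obtain ⟨g', -, rfl⟩ := Finset.mem_image.1 (Finset.mem_coe.1 hg)
      exact g'.2)
    refine ⟨pure x, ?_⟩
    simp only [Set.mem_iInter, Set.mem_ofPred_eq]
    exact fun g hg => hx g (Finset.mem_image_of_mem _ hg)
  have hXclosed : IsClosed X := isClosed_iInter fun g => ultrafilter_isClosed_basic _
  have hXmem : ∀ q, q ∈ X ↔ ∀ u v : R, u ≠ 0 → (fun x => u * x + v) ⁻¹' T ∈ q := by
    intro q
    simp only [X, Set.mem_iInter, Set.mem_ofPred_eq, Subtype.forall, affineSemigroup]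
    constructor
    · intro h u v hu
      exact h _ ⟨u, v, hu, rfl⟩
    · rintro h _ ⟨u, v, hu, rfl⟩
      exact h u v hu
  have hXadd : IsAddSubsystem X := by
    refine ⟨hXne, hXclosed.isCompact, fun v q hq => (hXmem _).2 fun a b ha => ?_⟩
    rw [Ultrafilter.mem_map]
    convert (hXmem q).1 hq a (a * v + b) ha using 1
    ext x
    simp only [Set.mem_preimage]
    ring_nf
  have hXmul : ∀ u : R, u ≠ 0 → ∀ q ∈ X, q.map (fun x => u * x) ∈ X := by
    intro u hu q hq
    refine (hXmem _).2 fun a b ha => ?_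
    rw [Ultrafilter.mem_map]
    convert (hXmem q).1 hq (a * u) b (mul_ne_zero ha hu) using 1
    ext x
    simp only [Set.mem_preimage]
    ring_nf
  have hYnp : closure (addMinimalIdempotents R ∩ X) ⊆ {p | IsNonprincipalUltrafilter p} :=
    closure_minimal (fun q hq => hq.1.1) (isClosed_setOf_isNonprincipalUltrafilter R)
  -- A multiplicative minimal idempotent found inside this system is automatically a limit of
  -- additive ones and contains T.
  have hY : IsMulSubsystem (closure (addMinimalIdempotents R ∩ X)) := by
    refine ⟨?_, isClosed_closure.isCompact, fun q hq => (hYnp hq).compl_singleton_mem 0,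
      fun u hu q hq => ?_⟩
    · obtain ⟨L, hLX, hL⟩ := hXadd.exists_minimal
      obtain ⟨q, hq, hqq⟩ := hL.prop.exists_idempotent
      exact ⟨q, subset_closure
        ⟨⟨IsAddSubsystem.isNonprincipal_of_minimal hL hq, ⟨L, hL, hq⟩, hqq⟩, hLX hq⟩⟩
    · exact map_mem_closure (Ultrafilter.continuous_map _) hq fun r hr =>
        ⟨hR.map_mul_mem_addMinimalIdempotents hu hr.1, hXmul u hu r hr.2⟩
  obtain ⟨Z, hZY, hZ⟩ := hY.exists_minimal
  obtain ⟨p, hp, hpp⟩ := hZ.prop.exists_idempotent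
  refine ⟨p, ⟨closure_mono Set.inter_subset_left (hZY hp), hYnp (hZY hp), ⟨Z, hZ, hp⟩, hpp⟩, ?_⟩
  have hpX : p ∈ X := closure_minimal Set.inter_subset_right hXclosed (hZY hp)
  simpa using (hXmem p).1 hpX 1 0 one_ne_zero

/-- In a large ideal domain, every `DC*` set is affinely syndetic. -/
theorem IsLID.isAffinelySyndetic_of_isDCStar (hR : IsLID R) {S : Set R} (hS : IsDCStar S) :
    IsAffinelySyndetic S := by
  by_contra hne
  have hDC : IsDC Sᶜ := by
    refine hR.isDC_of_affinely_thick fun G hG => ?_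
    by_contra hx
    push Not at hx
    refine hne ⟨G, G.finite_toSet, hG, Set.eq_univ_of_forall fun x => ?_⟩
    obtain ⟨g, hg, hgx⟩ := hx x
    exact Set.mem_biUnion hg (by simpa using hgx)
  obtain ⟨x, hx, hx'⟩ := hS _ hDC
  exact hx' hx

end UltrafilterDynamics

/-! ### Isometric representations of the affine group of a field -/

section AffineRepresentations

attribute [local instance] Ultrafilter.add Ultrafilter.mul

/-- Additive isometries `A v` and multiplicative isometries `M u` of an inner product space
satisfying the relations of the maps `f ↦ f (· + v)` and `f ↦ f (u * ·)`. -/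
structure AffineIsometries (K H : Type*) [Field K] [NormedAddCommGroup H]
    [InnerProductSpace ℝ H] where
  A : K → H →ₗᵢ[ℝ] H
  M : K → H →ₗᵢ[ℝ] H
  A_zero : ∀ x, A 0 x = x
  A_add : ∀ v w x, A (v + w) x = A v (A w x)
  M_one : ∀ x, M 1 x = x
  M_mul : ∀ u w, u ≠ 0 → w ≠ 0 → ∀ x, M (u * w) x = M u (M w x)
  A_M : ∀ v u, u ≠ 0 → ∀ x, A v (M u x) = M u (A (u * v) x)

namespace AffineIsometries

variable {K H : Type*} [Field K] [NormedAddCommGroup H] [InnerProductSpace ℝ H]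
  (ρ : AffineIsometries K H)

theorem M_inv_M {u : K} (hu : u ≠ 0) (x : H) : ρ.M u⁻¹ (ρ.M u x) = x := by
  rw [← ρ.M_mul _ _ (inv_ne_zero hu) hu, inv_mul_cancel₀ hu, ρ.M_one]

theorem M_M_inv {u : K} (hu : u ≠ 0) (x : H) : ρ.M u (ρ.M u⁻¹ x) = x := by
  rw [← ρ.M_mul _ _ hu (inv_ne_zero hu), mul_inv_cancel₀ hu, ρ.M_one]

theorem inner_M_left {u : K} (hu : u ≠ 0) (x y : H) :
    inner ℝ (ρ.M u x) y = inner ℝ x (ρ.M u⁻¹ y) := by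
  rw [← (ρ.M u⁻¹).inner_map_map, ρ.M_inv_M hu]

theorem M_A {u : K} (hu : u ≠ 0) (v : K) (x : H) : ρ.M u (ρ.A v x) = ρ.A (u⁻¹ * v) (ρ.M u x) := by
  rw [ρ.A_M _ _ hu, mul_inv_cancel_left₀ hu]

/-- The closed subspace of vectors whose orbit under translations by `R` is relatively compact. -/
def almostPeriodic [CompleteSpace H] (R : Subring K) : Submodule ℝ H where
  carrier := {x | TotallyBounded (Set.range fun v : R => ρ.A v x)}
  zero_mem' := (Set.finite_singleton (0 : H)).totallyBounded.subset (by
    rintro _ ⟨v, rfl⟩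
    simp)
  add_mem' {x y} hx hy := by
    have h1 := hx.closure.isCompact_of_isClosed isClosed_closure
    have h2 := hy.closure.isCompact_of_isClosed isClosed_closure
    refine (h1.add h2).totallyBounded.subset ?_
    rintro _ ⟨v, rfl⟩
    simp only [map_add]
    exact Set.add_mem_add (subset_closure ⟨v, rfl⟩) (subset_closure ⟨v, rfl⟩)
  smul_mem' c x hx := by
    refine (hx.image (uniformContinuous_const_smul c)).subset ?_
    rintro _ ⟨v, rfl⟩
    exact ⟨ρ.A v x, ⟨v, rfl⟩, by simp⟩

variable [CompleteSpace H] {R : Subring K}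

theorem mem_almostPeriodic {x : H} :
    x ∈ ρ.almostPeriodic R ↔ TotallyBounded (Set.range fun v : R => ρ.A v x) := Iff.rfl

theorem mem_almostPeriodic_of_fixed {x : H} (hx : ∀ v, ρ.A v x = x) : x ∈ ρ.almostPeriodic R :=
  (Set.finite_singleton x).totallyBounded.subset (by
    rintro _ ⟨v, rfl⟩
    simp [hx])

variable (R) in
theorem isClosed_almostPeriodic : IsClosed (ρ.almostPeriodic R : Set H) := by
  rw [← closure_subset_iff_isClosed]
  intro x hx
  rw [SetLike.mem_coe, mem_almostPeriodic, Metric.totallyBounded_iff]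
  intro ε hε
  obtain ⟨y, hy, hxy⟩ := Metric.mem_closure_iff.1 hx (ε / 2) (half_pos hε)
  obtain ⟨t, ht, hty⟩ := Metric.totallyBounded_iff.1 hy (ε / 2) (half_pos hε)
  refine ⟨t, ht, ?_⟩
  rintro _ ⟨v, rfl⟩
  have h1 := hty ⟨v, rfl⟩
  simp only [Set.mem_iUnion, Metric.mem_ball, exists_prop] at h1 ⊢
  obtain ⟨z, hz, hyz⟩ := h1
  refine ⟨z, hz, (dist_triangle _ (ρ.A v y) _).trans_lt ?_⟩
  rw [(ρ.A v).dist_map]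
  linarith

/-- Relative compactness of the orbit under a non-zero ideal suffices. -/
theorem mem_almostPeriodic_of_mul (hR : IsLID R) {c : R} (hc : c ≠ 0) {x : H}
    (hx : TotallyBounded (Set.range fun v : R => ρ.A (c * v) x)) : x ∈ ρ.almostPeriodic R := by
  obtain ⟨W, hW⟩ := hR.exists_finset_cosets hc
  have h1 := hx.closure.isCompact_of_isClosed isClosed_closure
  refine (W.isCompact_biUnion fun w _ =>
    h1.image (ρ.A w).continuous).totallyBounded.subset ?_
  rintro _ ⟨v, rfl⟩
  obtain ⟨w, hw, r, rfl⟩ := hW v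
  refine Set.mem_biUnion hw ⟨_, subset_closure ⟨r, rfl⟩, ?_⟩
  rw [← ρ.A_add]
  push_cast
  rfl

theorem M_mem_almostPeriodic {u : R} (hu : u ≠ 0) {x : H} (hx : x ∈ ρ.almostPeriodic R) :
    ρ.M u x ∈ ρ.almostPeriodic R := by
  have hu' : (u : K) ≠ 0 := by simpa using hu
  refine (TotallyBounded.image hx (ρ.M u).isometry.uniformContinuous).subset ?_
  rintro _ ⟨v, rfl⟩
  refine ⟨_, ⟨u * v, rfl⟩, ?_⟩
  simp only [ρ.A_M _ _ hu']
  push_cast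
  rfl

/-- The relation A_{uv} M_u⁻¹ = M_u⁻¹ A_v controls only the orbit under uR, so finite index is
essential. -/
theorem M_inv_mem_almostPeriodic (hR : IsLID R) {u : R} (hu : u ≠ 0) {x : H}
    (hx : x ∈ ρ.almostPeriodic R) : ρ.M (u : K)⁻¹ x ∈ ρ.almostPeriodic R := by
  have hu' : (u : K) ≠ 0 := by simpa using hu
  refine ρ.mem_almostPeriodic_of_mul hR hu
    ((TotallyBounded.image hx (ρ.M (u : K)⁻¹).isometry.uniformContinuous).subset ?_)
  rintro _ ⟨v, rfl⟩
  refine ⟨_, ⟨v, rfl⟩, ?_⟩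
  simp only
  rw [ρ.A_M _ _ (inv_ne_zero hu'), inv_mul_cancel_left₀ hu']

/-- Almost periodic vectors are recurrent along idempotent ultrafilters. -/
theorem tendsto_A_of_mem_almostPeriodic {q : Ultrafilter R} (hq : q + q = q) {x : H}
    (hx : x ∈ ρ.almostPeriodic R) :
    Tendsto (fun v : R => ρ.A v x) q (𝓝 x) := by
  have h1 := TotallyBounded.closure hx |>.isCompact_of_isClosed isClosed_closure
  obtain ⟨y, -, hy⟩ := h1.ultrafilter_le_nhds (q.map fun v : R => ρ.A v x) (by
    rw [le_principal_iff, Ultrafilter.mem_coe, Ultrafilter.mem_map]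
    exact Filter.univ_mem' fun v => subset_closure ⟨v, rfl⟩)
  have hy' : Tendsto (fun v : R => ρ.A v x) q (𝓝 y) := hy
  rw [Metric.tendsto_nhds]
  intro ε hε
  have h2 := Metric.tendsto_nhds.1 hy' (ε / 4) (by positivity)
  have h3 : ∀ᶠ v : R in ((q + q : Ultrafilter R) : Filter R), dist (ρ.A v x) y < ε / 4 := by
    rwa [hq]
  rw [Ultrafilter.eventually_add] at h3
  filter_upwards [h3] with u hu
  obtain ⟨v, hv, hv'⟩ := (hu.and h2).exists
  have h4 : dist (ρ.A u (ρ.A v x)) y < ε / 4 := by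
    rw [← ρ.A_add]
    simpa using hv
  have h5 : dist (ρ.A u (ρ.A v x)) (ρ.A u y) < ε / 4 := by rwa [(ρ.A u).dist_map]
  -- Translations commute, so closeness at A_v x transfers back to x.
  have h6 : dist (ρ.A u (ρ.A v x)) (ρ.A v x) = dist (ρ.A u x) x := by
    rw [← ρ.A_add, add_comm, ρ.A_add, (ρ.A v).dist_map]
  have h7 := dist_triangle_right (ρ.A u (ρ.A v x)) (ρ.A v x) y
  rw [h6] at h7
  linarith

/-- A vector that is recurrent along an additive minimal ultrafilter is almost periodic. -/
theorem mem_almostPeriodic_of_tendsto (hR : IsLID R) {X : Set (Ultrafilter R)}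
    (hX : Minimal IsAddSubsystem X) {q : Ultrafilter R} (hq : q ∈ X) {c : R} (hc : c ≠ 0) {x : H}
    (hx : Tendsto (fun v : R => ρ.A (c * v) x) q (𝓝 x)) : x ∈ ρ.almostPeriodic R := by
  refine ρ.mem_almostPeriodic_of_mul hR hc (Metric.totallyBounded_iff.2 fun ε hε => ?_)
  obtain ⟨W, hW⟩ := IsAddSubsystem.exists_finset_differences hX hq
    (Metric.tendsto_nhds.1 hx (ε / 2) (half_pos hε))
  classical
  refine ⟨(fun w : R => ρ.A (c * w) x) '' W, W.finite_toSet.image _, ?_⟩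
  rintro _ ⟨v, rfl⟩
  obtain ⟨w, hw, a, ha, b, hb, hab⟩ := hW v
  refine Set.mem_biUnion ⟨w, hw, rfl⟩ ?_
  rw [Set.mem_ofPred_eq] at ha hb
  -- Both A_{ca} x and A_{cb} x are near x, so A_{cv} x and A_{cw} x are near this common vector.
  have h1 : ρ.A (c * v) (ρ.A (c * a) x) = ρ.A (c * w) (ρ.A (c * b) x) := by
    rw [← ρ.A_add, ← ρ.A_add, ← mul_add, ← mul_add]
    congr 3
    exact_mod_cast hab
  rw [← (ρ.A (c * v)).dist_map, h1] at ha
  rw [← (ρ.A (c * w)).dist_map] at hb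
  have h2 := dist_triangle_left (ρ.A (c * v) x) (ρ.A (c * w) x) (ρ.A (c * w) (ρ.A (c * b) x))
  rw [Metric.mem_ball]
  linarith

/-- Vectors orthogonal to the almost periodic ones are weakly mixing along additive minimal
idempotents and their limits. -/
theorem tendsto_inner_A_zero (hR : IsLID R) {p : Ultrafilter R}
    (hp : p ∈ closure (addMinimalIdempotents R)) {c : R} (hc : c ≠ 0) (g : H) {f : H}
    (hf : f ∈ (ρ.almostPeriodic R)ᗮ) :
    Tendsto (fun v : R => inner ℝ (ρ.A (c * v) g) f) p (𝓝 0) := by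
  rw [Metric.tendsto_nhds]
  intro ε hε
  refine Ultrafilter.mem_of_mem_closure hp fun q hq => ?_
  obtain ⟨-, ⟨X, hX, hqX⟩, hidem⟩ := hq
  obtain ⟨x, hx, hfix, -⟩ := q.exists_weak_limit_of_idempotent (· + ·)
    (fun s hs => by rw [← hidem] at hs; exact hs) (fun v => ρ.A (c * v))
    (Eventually.of_forall fun u => Eventually.of_forall fun v x => by
      rw [← ρ.A_add]; push_cast; rw [mul_add]) g
  have h1 := ρ.mem_almostPeriodic_of_tendsto hR hX hqX hc hfix
  have h2 := hx f
  rw [Submodule.inner_right_of_mem_orthogonal h1 hf] at h2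
  exact Metric.tendsto_nhds.1 h2 ε hε

/-- The infinite set of non-zero elements of a member of a non-principal ultrafilter has
arbitrarily large finite subsets with distinct squares. -/
theorem _root_.IsNonprincipalUltrafilter.exists_finset_sq_injOn {R : Type*} [CommRing R]
    [IsDomain R] {p : Ultrafilter R} (hp : IsNonprincipalUltrafilter p) {B : Set R} (hB : B ∈ p)
    (N : ℕ) : ∃ s : Finset R, (s : Set R) ⊆ B \ {0} ∧ s.card = N ∧
      Set.InjOn (fun b : R => b ^ 2) s := by
  have hinf : (B \ {0}).Infinite := by
    intro hfin
    have h1 := Filter.inter_mem (Filter.inter_mem hB (hp.compl_singleton_mem 0))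
      (hp.compl_finite_mem hfin)
    obtain ⟨x, hx⟩ := p.nonempty_of_mem h1
    exact hx.2 hx.1
  -- Squaring on a domain has fibres of at most two points.
  have hsq : ((fun b : R => b ^ 2) '' (B \ {0})).Infinite := by
    refine fun hfin => hinf (Set.Finite.of_finite_fibers (fun b : R => b ^ 2) hfin fun y _ => ?_)
    by_cases hy : ∃ z : R, z ^ 2 = y
    · obtain ⟨z, rfl⟩ := hy
      refine (Set.toFinite {z, -z}).subset ?_
      rintro x ⟨-, hx⟩
      exact sq_eq_sq_iff_eq_or_eq_neg.1 hx
    · exact Set.finite_empty.subset fun x hx => hy ⟨x, hx.2⟩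
  obtain ⟨t, ht, htN⟩ := hsq.exists_subset_card_eq N
  obtain ⟨u, hu, hbij⟩ := Set.SurjOn.exists_bijOn_subset (f := fun b : R => b ^ 2) (s := B \ {0})
    (t := (t : Set R)) ht
  have hfin : u.Finite := hbij.finite_iff_finite.2 t.finite_toSet
  refine ⟨hfin.toFinset, by simpa using hu, ?_, by simpa using hbij.injOn⟩
  rw [← htN, ← Set.ncard_coe_finset, ← Set.ncard_coe_finset, hfin.coe_toFinset, ← hbij.image_eq,
    hbij.injOn.ncard_image]

/-- The mixing part of the ergodic theorem for `M_{1/u} A_u`. -/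
theorem tendsto_inner_A_M_zero (hR : IsLID R) {p : Ultrafilter R}
    (hp : p ∈ closure (addMinimalIdempotents R)) (hnp : IsNonprincipalUltrafilter p)
    (hpp : p * p = p) {f : H} (hf : f ∈ (ρ.almostPeriodic R)ᗮ) (e : H) :
    Tendsto (fun u : R => inner ℝ (ρ.A u f) (ρ.M u e)) p (𝓝 0) := by
  have := hR.isDomain
  have hMf : ∀ b : R, b ≠ 0 → ρ.M (b : K)⁻¹ f ∈ (ρ.almostPeriodic R)ᗮ := by
    intro b hb
    rw [Submodule.mem_orthogonal]
    intro k hk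
    have hb' : (b : K) ≠ 0 := by simpa using hb
    rw [← (ρ.M b).inner_map_map, ρ.M_M_inv hb']
    exact Submodule.inner_right_of_mem_orthogonal (ρ.M_mem_almostPeriodic hb hk) hf
  have hmain := p.tendsto_inner_zero_of_shifts_orthogonal (fun b u => b * u)
    (fun s hs => by rw [← hpp] at hs; exact hs) (fun u : R => ρ.M (u : K)⁻¹ (ρ.A u f)) ‖f‖
    (fun u => by rw [LinearIsometry.norm_map, LinearIsometry.norm_map]) (fun B hB N => by
      obtain ⟨s, hsB, hsN, hinj⟩ := hnp.exists_finset_sq_injOn hB N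
      refine ⟨s, hsB.trans Set.sdiff_subset, hsN, fun b hb c hc hbc => ?_⟩
      have hb0 : b ≠ 0 := (hsB hb).2
      have hc0 : c ≠ 0 := (hsB hc).2
      have hd : b ^ 2 - c ^ 2 ≠ 0 := sub_ne_zero.2 fun h => hbc (hinj hb hc h)
      refine (ρ.tendsto_inner_A_zero hR hp hd (ρ.M (b : K)⁻¹ f) (hMf c hc0)).congr' ?_
      filter_upwards [hnp.compl_singleton_mem 0] with u hu
      have hu0 : (u : K) ≠ 0 := by simpa using hu
      have hb0' : (b : K) ≠ 0 := by simpa using hb0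
      have hc0' : (c : K) ≠ 0 := by simpa using hc0
      -- Applying M_u to both shifts removes the dilation by u; moving M_b⁻¹ past A_{bu} produces
      -- the square.
      have h1 : ∀ b : K, b ≠ 0 → ρ.M u (ρ.M (b * u)⁻¹ (ρ.A (b * u) f)) =
          ρ.A (b ^ 2 * u) (ρ.M b⁻¹ f) := by
        intro b hb
        rw [← ρ.M_mul _ _ hu0 (inv_ne_zero (mul_ne_zero hb hu0)), mul_inv_rev,
          mul_inv_cancel_left₀ hu0, ρ.M_A (inv_ne_zero hb), inv_inv, ← mul_assoc, sq]
      push_cast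
      rw [← (ρ.M u).inner_map_map (ρ.M (b * u : K)⁻¹ (ρ.A (b * u) f)), h1 _ hb0', h1 _ hc0',
        ← (ρ.A (c ^ 2 * u : K)).inner_map_map (ρ.A ((b ^ 2 - c ^ 2) * u : K) _), ← ρ.A_add,
        ← add_mul, add_sub_cancel]) e
  refine hmain.congr' ?_
  filter_upwards [hnp.compl_singleton_mem 0] with u hu
  have hu0 : (u : K) ≠ 0 := by simpa using hu
  rw [ρ.inner_M_left (inv_ne_zero hu0), inv_inv]

/-- Along double central ultrafilters, the correlations of `A_u e` and `M_u e` asymptotically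
dominate the square of the component of `e` along a fixed unit vector. -/
theorem eventually_sq_inner_sub_lt (hR : IsLID R) {p : Ultrafilter R}
    (hp : p ∈ doubleCentralUltrafilters R) {o : H} (ho : ‖o‖ = 1) (hAo : ∀ v, ρ.A v o = o)
    (hMo : ∀ u, u ≠ 0 → ρ.M u o = o) (e : H) {ε : ℝ} (hε : 0 < ε) :
    ∀ᶠ u : R in (p : Filter R), inner ℝ e o ^ 2 - ε < inner ℝ (ρ.A u e) (ρ.M u e) := by
  have := hR.isDomain
  obtain ⟨hcl, hnp, -, hpp⟩ := hp
  have hne := hnp.compl_singleton_mem 0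
  have hclosed := ρ.isClosed_almostPeriodic R
  have : CompleteSpace (ρ.almostPeriodic R) := hclosed.completeSpace_coe
  obtain ⟨k, hk, f, hf, rfl⟩ := (ρ.almostPeriodic R).exists_add_mem_mem_orthogonal e
  have hfo : inner ℝ f o = 0 := by
    rw [real_inner_comm]
    exact Submodule.inner_right_of_mem_orthogonal (ρ.mem_almostPeriodic_of_fixed hAo) hf
  obtain ⟨x, hx, -, hkx⟩ := p.exists_weak_limit_of_idempotent (· * ·)
    (fun s hs => by rw [← hpp] at hs; exact hs) (fun u : R => ρ.M u) (by
      filter_upwards [hne] with u hu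
      filter_upwards [hne] with v hv x
      have := ρ.M_mul u v (by simpa using hu) (by simpa using hv) x
      simpa using this) k
  have hxo : inner ℝ x o = inner ℝ k o := by
    refine tendsto_nhds_unique (hx o) (tendsto_const_nhds.congr' ?_)
    filter_upwards [hne] with u hu
    have hu0 : (u : K) ≠ 0 := by simpa using hu
    rw [← (ρ.M u).inner_map_map, hMo _ hu0]
  -- Cauchy–Schwarz against the fixed unit vector: ⟨k, o⟩² = ⟨x, o⟩² ≤ ‖x‖² = ⟨x, k⟩.
  have hsq : inner ℝ k o ^ 2 ≤ inner ℝ x k := by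
    rw [real_inner_comm k x, hkx, ← hxo, ← sq_abs]
    refine pow_le_pow_left₀ (abs_nonneg _) ?_ 2
    simpa [ho] using abs_real_inner_le_norm x o
  have h1 := (ρ.tendsto_inner_A_M_zero hR hcl hnp hpp hf (k + f)).eventually_const_lt
    (show -(ε / 3) < 0 by linarith)
  have h2 := (hx k).eventually_const_lt (show inner ℝ x k - ε / 3 < inner ℝ x k by linarith)
  have h3 : ∀ᶠ u : R in (p : Filter R), ‖ρ.A u k - k‖ * ‖k + f‖ < ε / 3 := by
    refine Ultrafilter.mem_of_mem_closure hcl fun q hq => ?_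
    have h4 := (ρ.tendsto_A_of_mem_almostPeriodic hq.2.2 hk)
    rw [tendsto_iff_norm_sub_tendsto_zero] at h4
    have h5 := h4.mul_const ‖k + f‖
    rw [zero_mul] at h5
    exact h5.eventually_lt_const (by linarith)
  filter_upwards [h1, h2, h3, hne] with u hu1 hu2 hu3 hu
  have hu0 : (u : K) ≠ 0 := by simpa using hu
  have h4 : inner ℝ k (ρ.M u (k + f)) = inner ℝ (ρ.M u k) k := by
    rw [real_inner_comm, map_add, inner_add_left, ρ.inner_M_left hu0 f, real_inner_comm _ f,
      Submodule.inner_right_of_mem_orthogonal (ρ.M_inv_mem_almostPeriodic hR hu hk) hf, add_zero]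
  have h5 : -(‖ρ.A u k - k‖ * ‖k + f‖) ≤ inner ℝ (ρ.A u k - k) (ρ.M u (k + f)) := by
    have h6 := abs_real_inner_le_norm (ρ.A u k - k) (ρ.M u (k + f))
    rw [(ρ.M u).norm_map] at h6
    exact (abs_le.1 h6).1
  have h6 : inner ℝ (ρ.A u (k + f)) (ρ.M u (k + f)) = inner ℝ k (ρ.M u (k + f)) +
      inner ℝ (ρ.A u k - k) (ρ.M u (k + f)) + inner ℝ (ρ.A u f) (ρ.M u (k + f)) := by
    rw [(ρ.A u).map_add, inner_add_left, inner_sub_left]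
    ring
  rw [h6, h4, inner_add_left, hfo, add_zero]
  linarith

end AffineIsometries

end AffineRepresentations

/-! ### Means along ultrafilters and their Hilbert spaces -/

section Means

variable {K : Type*}

/-- The space of bounded real functions. -/
def boundedFunctions (K : Type*) : Submodule ℝ (K → ℝ) where
  carrier := {f | ∃ C, ∀ x, |f x| ≤ C}
  zero_mem' := ⟨0, fun x => by simp⟩
  add_mem' {f g} hf hg := by
    obtain ⟨C, hC⟩ := hf
    obtain ⟨D, hD⟩ := hg
    exact ⟨C + D, fun x => (abs_add_le _ _).trans (add_le_add (hC x) (hD x))⟩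
  smul_mem' c f hf := by
    obtain ⟨C, hC⟩ := hf
    refine ⟨|c| * C, fun x => ?_⟩
    rw [Pi.smul_apply, smul_eq_mul, abs_mul]
    exact mul_le_mul_of_nonneg_left (hC x) (abs_nonneg c)

theorem mul_mem_boundedFunctions {f g : K → ℝ} (hf : f ∈ boundedFunctions K)
    (hg : g ∈ boundedFunctions K) : f * g ∈ boundedFunctions K := by
  obtain ⟨C, hC⟩ := hf
  obtain ⟨D, hD⟩ := hg
  refine ⟨C * D, fun x => ?_⟩
  rw [Pi.mul_apply, abs_mul]
  exact mul_le_mul (hC x) (hD x) (abs_nonneg _) ((abs_nonneg _).trans (hC x))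

theorem comp_mem_boundedFunctions {f : K → ℝ} (hf : f ∈ boundedFunctions K) (σ : K → K) :
    f ∘ σ ∈ boundedFunctions K := by
  obtain ⟨C, hC⟩ := hf
  exact ⟨C, fun x => hC _⟩

theorem indicator_one_mem_boundedFunctions (A : Set K) :
    A.indicator 1 ∈ boundedFunctions K := by
  refine ⟨1, fun x => ?_⟩
  by_cases hx : x ∈ A <;> simp [hx]

/-- The average of a function over a finite set. -/
noncomputable def finsetAverage (s : Finset K) (f : K → ℝ) : ℝ := (∑ x ∈ s, f x) / s.card

theorem abs_finsetAverage_le (s : Finset K) {f : K → ℝ} {C : ℝ} (hC : ∀ x, |f x| ≤ C)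
    (hC0 : 0 ≤ C) : |finsetAverage s f| ≤ C := by
  rw [finsetAverage, abs_div, Nat.abs_cast]
  refine div_le_of_le_mul₀ (Nat.cast_nonneg _) hC0 ?_
  calc |∑ x ∈ s, f x| ≤ ∑ x ∈ s, |f x| := Finset.abs_sum_le_sum_abs _ _
    _ ≤ s.card • C := Finset.sum_le_card_nsmul _ _ _ fun x _ => hC x
    _ = C * s.card := by rw [nsmul_eq_mul, mul_comm]

theorem finsetAverage_indicator (s : Finset K) (A : Set K) :
    finsetAverage s (A.indicator 1) = ((A ∩ (s : Set K)).ncard : ℝ) / s.card := by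
  classical
  have h : A ∩ (s : Set K) = ((s.filter (· ∈ A) : Finset K) : Set K) := by
    ext x
    simp [and_comm]
  rw [finsetAverage, h, Set.ncard_coe_finset]
  congr 1
  simp [Set.indicator_apply]

theorem ncard_inter_div_card_le_one (s : Finset K) (A : Set K) :
    ((A ∩ (s : Set K)).ncard : ℝ) / s.card ≤ 1 := by
  refine div_le_one_of_le₀ ?_ (Nat.cast_nonneg _)
  rw [← Set.ncard_coe_finset s]
  exact_mod_cast Set.ncard_le_ncard Set.inter_subset_right s.finite_toSet

/-- The two sums differ only over σ(s) \ s and s \ σ(s), which have equal size by injectivity. -/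
theorem abs_finsetAverage_comp_sub_le (s : Finset K) {f : K → ℝ} {C : ℝ} (hC : ∀ x, |f x| ≤ C)
    (hC0 : 0 ≤ C) {σ : K → K} (hσ : Function.Injective σ) :
    |finsetAverage s (f ∘ σ) - finsetAverage s f| ≤
      2 * C * (1 - (((s : Set K) ∩ σ '' (s : Set K)).ncard : ℝ) / s.card) := by
  classical
  have hint : (s : Set K) ∩ σ '' (s : Set K) = ((s ∩ s.image σ : Finset K) : Set K) := by simp
  rw [hint, Set.ncard_coe_finset]
  rcases s.eq_empty_or_nonempty with rfl | hs
  · simpa [finsetAverage] using hC0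
  have hcard : 0 < (s.card : ℝ) := by exact_mod_cast hs.card_pos
  have h1 : ∑ x ∈ s, (f ∘ σ) x = ∑ x ∈ s.image σ, f x := by
    rw [Finset.sum_image hσ.injOn]
    rfl
  have hb : ∀ t : Finset K, |∑ x ∈ t, f x| ≤ t.card * C := fun t =>
    (Finset.abs_sum_le_sum_abs _ _).trans
      ((Finset.sum_le_card_nsmul _ _ _ fun x _ => hC x).trans_eq (nsmul_eq_mul _ _))
  have h2 : ∑ x ∈ s.image σ, f x - ∑ x ∈ s, f x =
      ∑ x ∈ s.image σ \ s, f x - ∑ x ∈ s \ s.image σ, f x := by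
    rw [Finset.sum_sdiff_sub_sum_sdiff]
  have h3 : ((s.image σ \ s).card : ℝ) = s.card - (s ∩ s.image σ).card := by
    have := Finset.card_sdiff_add_card_inter (s.image σ) s
    rw [Finset.card_image_of_injective _ hσ, Finset.inter_comm] at this
    rw [eq_sub_iff_add_eq]
    exact_mod_cast this
  have h4 : ((s \ s.image σ).card : ℝ) = s.card - (s ∩ s.image σ).card := by
    have := Finset.card_sdiff_add_card_inter s (s.image σ)
    rw [eq_sub_iff_add_eq]
    exact_mod_cast this
  rw [finsetAverage, finsetAverage, h1, ← sub_div, h2, abs_div, abs_of_pos hcard,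
    div_le_iff₀ hcard]
  calc |∑ x ∈ s.image σ \ s, f x - ∑ x ∈ s \ s.image σ, f x|
      ≤ |∑ x ∈ s.image σ \ s, f x| + |∑ x ∈ s \ s.image σ, f x| := abs_sub _ _
    _ ≤ (s.image σ \ s).card * C + (s \ s.image σ).card * C := add_le_add (hb _) (hb _)
    _ = _ := by
      rw [h3, h4]
      field_simp
      ring

/-- The limit of the averages of a function along an ultrafilter. -/
noncomputable def ultraMean (F : ℕ → Finset K) (U : Ultrafilter ℕ) (f : K → ℝ) : ℝ :=
  limUnder (U : Filter ℕ) fun N => finsetAverage (F N) f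

variable (F : ℕ → Finset K) (U : Ultrafilter ℕ)

theorem tendsto_ultraMean {f : K → ℝ} (hf : f ∈ boundedFunctions K) :
    Tendsto (fun N => finsetAverage (F N) f) U (𝓝 (ultraMean F U f)) := by
  obtain ⟨C, hC⟩ := hf
  obtain ⟨l, -, hl⟩ := (isCompact_Icc (a := -|C|) (b := |C|)).ultrafilter_le_nhds
    (U.map fun N => finsetAverage (F N) f) (by
      rw [le_principal_iff, Ultrafilter.mem_coe, Ultrafilter.mem_map]
      exact Filter.univ_mem' fun N => abs_le.1
        (abs_finsetAverage_le _ (fun x => (hC x).trans (le_abs_self C)) (abs_nonneg C)))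
  exact tendsto_nhds_limUnder ⟨l, hl⟩

variable {F U}

theorem ultraMean_eq {f : K → ℝ} {l : ℝ}
    (h : Tendsto (fun N => finsetAverage (F N) f) U (𝓝 l)) : ultraMean F U f = l :=
  h.limUnder_eq

theorem ultraMean_nonneg {f : K → ℝ} (hf : f ∈ boundedFunctions K) (h0 : ∀ x, 0 ≤ f x) :
    0 ≤ ultraMean F U f :=
  ge_of_tendsto' (tendsto_ultraMean F U hf) fun _ =>
    div_nonneg (Finset.sum_nonneg fun x _ => h0 x) (Nat.cast_nonneg _)

theorem ultraMean_add {f g : K → ℝ} (hf : f ∈ boundedFunctions K) (hg : g ∈ boundedFunctions K) :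
    ultraMean F U (f + g) = ultraMean F U f + ultraMean F U g := by
  refine ultraMean_eq (((tendsto_ultraMean F U hf).add (tendsto_ultraMean F U hg)).congr
    fun N => ?_)
  simp only [finsetAverage, Pi.add_apply, Finset.sum_add_distrib, add_div]

theorem ultraMean_smul {f : K → ℝ} (hf : f ∈ boundedFunctions K) (c : ℝ) :
    ultraMean F U (c • f) = c * ultraMean F U f := by
  refine ultraMean_eq (((tendsto_ultraMean F U hf).const_mul c).congr fun N => ?_)
  simp only [finsetAverage, Pi.smul_apply, smul_eq_mul, ← Finset.mul_sum, mul_div_assoc]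

/-- The mean is invariant under maps that asymptotically preserve the averaging sets. -/
theorem ultraMean_comp (hU : (U : Filter ℕ) ≤ atTop) {f : K → ℝ} (hf : f ∈ boundedFunctions K)
    {σ : K → K} (hσ : Function.Injective σ)
    (hF : Tendsto (fun N => (((F N : Set K) ∩ σ '' (F N : Set K)).ncard : ℝ) / ((F N).card : ℝ))
      atTop (𝓝 1)) :
    ultraMean F U (f ∘ σ) = ultraMean F U f := by
  obtain ⟨C, hC⟩ := id hf
  have h1 : Tendsto (fun N => finsetAverage (F N) (f ∘ σ) - finsetAverage (F N) f) U (𝓝 0) := by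
    refine squeeze_zero_norm (fun N => abs_finsetAverage_comp_sub_le (F N)
      (fun x => (hC x).trans (le_abs_self C)) (abs_nonneg C) hσ) ?_
    have h2 := ((hF.mono_left hU).const_sub 1).const_mul (2 * |C|)
    simpa using h2
  have h2 := h1.add (tendsto_ultraMean F U hf)
  rw [zero_add] at h2
  exact ultraMean_eq (h2.congr fun N => by ring)

variable (F) in
-- The limsup of a bounded sequence is a cluster point, hence a limit along some ultrafilter.
theorem exists_ultraMean_indicator_eq (E : Set K) :
    ∃ U : Ultrafilter ℕ, (U : Filter ℕ) ≤ atTop ∧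
      ultraMean F U (E.indicator 1) = folnerUpperDensity F E := by
  let d : ℕ → ℝ := fun N => ((E ∩ (F N : Set K)).ncard : ℝ) / ((F N).card : ℝ)
  have hd0 : ∀ N, 0 ≤ d N := fun N => by positivity
  have hd1 : ∀ N, d N ≤ 1 := fun N => ncard_inter_div_card_le_one _ _
  have hbdd : IsBoundedUnder (· ≤ ·) atTop d := isBoundedUnder_of ⟨1, hd1⟩
  have hcobdd : IsCoboundedUnder (· ≤ ·) atTop d :=
    (isBoundedUnder_of ⟨0, hd0⟩ : IsBoundedUnder (· ≥ ·) atTop d).isCoboundedUnder_le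
  have hcl : MapClusterPt (limsup d atTop) atTop d := by
    rw [mapClusterPt_iff_frequently]
    intro s hs
    obtain ⟨δ, hδ, hs⟩ := Metric.mem_nhds_iff.1 hs
    have h1 : ∃ᶠ N in atTop, limsup d atTop - δ < d N :=
      frequently_lt_of_lt_limsup hcobdd (by linarith)
    have h2 : ∀ᶠ N in atTop, d N < limsup d atTop + δ :=
      eventually_lt_of_limsup_lt (by linarith) hbdd
    refine (h1.and_eventually h2).mono fun N hN => hs ?_
    rw [Metric.mem_ball, Real.dist_eq, abs_lt]
    constructor <;> linarith [hN.1, hN.2]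
  obtain ⟨U, hU, hlim⟩ := mapClusterPt_iff_ultrafilter.1 hcl
  exact ⟨U, hU, ultraMean_eq (by simp only [finsetAverage_indicator]; exact hlim)⟩

theorem ultraMean_indicator_le (hU : (U : Filter ℕ) ≤ atTop) (A : Set K) :
    ultraMean F U (A.indicator 1) ≤ folnerUpperDensity F A := by
  have hlim := tendsto_ultraMean F U (indicator_one_mem_boundedFunctions A)
  simp only [finsetAverage_indicator] at hlim
  by_contra! hlt
  obtain ⟨c, hc, hc'⟩ := exists_between hlt
  have h1 : ∀ᶠ N in atTop, ((A ∩ (F N : Set K)).ncard : ℝ) / ((F N).card : ℝ) < c :=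
    eventually_lt_of_limsup_lt hc
      (isBoundedUnder_of ⟨1, fun N => ncard_inter_div_card_le_one _ _⟩)
  have h2 : ultraMean F U (A.indicator 1) ≤ c :=
    le_of_tendsto hlim (hU (h1.mono fun N hN => hN.le))
  linarith

/-! #### The pre-Hilbert space of a mean -/

/-- Bounded functions with the inner product `⟨f, g⟩ = m (f g)` of the mean `m` along `F`
and `U`. -/
def MeanSpace (_F : ℕ → Finset K) (_U : Ultrafilter ℕ) : Type _ := boundedFunctions K

namespace MeanSpace

noncomputable instance : AddCommGroup (MeanSpace F U) :=
  inferInstanceAs (AddCommGroup (boundedFunctions K))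

noncomputable instance : Module ℝ (MeanSpace F U) :=
  inferInstanceAs (Module ℝ (boundedFunctions K))

/-- The underlying function. -/
def toFun (f : MeanSpace F U) : K → ℝ := f.1

theorem toFun_mul_mem (f g : MeanSpace F U) : f.toFun * g.toFun ∈ boundedFunctions K :=
  mul_mem_boundedFunctions f.2 g.2

/-- The form is only semidefinite; the Hausdorff completion kills the null functions. -/
noncomputable instance core : PreInnerProductSpace.Core ℝ (MeanSpace F U) where
  inner f g := ultraMean F U (f.toFun * g.toFun)
  conj_inner_symm f g := by
    rw [mul_comm]
    rfl
  re_inner_nonneg f := ultraMean_nonneg (f.toFun_mul_mem f) fun x => mul_self_nonneg (f.toFun x)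
  add_left f g h := by
    rw [← ultraMean_add (f.toFun_mul_mem h) (g.toFun_mul_mem h), ← add_mul]
    rfl
  smul_left f g c := by
    refine Eq.trans ?_ (ultraMean_smul (f.toFun_mul_mem g) c)
    rw [← smul_mul_assoc]
    rfl

noncomputable instance : SeminormedAddCommGroup (MeanSpace F U) :=
  InnerProductSpace.Core.toSeminormedAddCommGroup (𝕜 := ℝ)

noncomputable instance : InnerProductSpace ℝ (MeanSpace F U) :=
  InnerProductSpace.ofCore core

theorem inner_def (f g : MeanSpace F U) :
    inner ℝ f g = ultraMean F U (f.toFun * g.toFun) := rfl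

/-- Composition with a map, as a linear endomorphism. -/
noncomputable def compLinearMap (F : ℕ → Finset K) (U : Ultrafilter ℕ) (σ : K → K) :
    MeanSpace F U →ₗ[ℝ] MeanSpace F U :=
  ((LinearMap.funLeft ℝ ℝ σ).restrict fun _ hf => comp_mem_boundedFunctions hf σ :
    boundedFunctions K →ₗ[ℝ] boundedFunctions K)

theorem toFun_compLinearMap (σ : K → K) (f : MeanSpace F U) :
    (compLinearMap F U σ f).toFun = f.toFun ∘ σ := rfl

/-- Composition with a map that preserves the mean. -/
noncomputable def compIsometry (σ : K → K)
    (hσ : ∀ f ∈ boundedFunctions K, ultraMean F U (f ∘ σ) = ultraMean F U f) :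
    MeanSpace F U →ₗᵢ[ℝ] MeanSpace F U :=
  (compLinearMap F U σ).isometryOfInner fun f g => by
    rw [inner_def, inner_def, toFun_compLinearMap, toFun_compLinearMap,
      ← hσ _ (f.toFun_mul_mem g)]
    rfl

theorem toFun_compIsometry (σ : K → K)
    (hσ : ∀ f ∈ boundedFunctions K, ultraMean F U (f ∘ σ) = ultraMean F U f)
    (f : MeanSpace F U) : (compIsometry σ hσ f).toFun = f.toFun ∘ σ := rfl

theorem ext {f g : MeanSpace F U} (h : f.toFun = g.toFun) : f = g := Subtype.ext h

end MeanSpace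

/-- The extension of a linear isometry to the completion. -/
noncomputable def LinearIsometry.completionMap {V : Type*} [SeminormedAddCommGroup V]
    [InnerProductSpace ℝ V] (T : V →ₗᵢ[ℝ] V) :
    UniformSpace.Completion V →ₗᵢ[ℝ] UniformSpace.Completion V where
  toLinearMap := (T.toContinuousLinearMap.completion).toLinearMap
  norm_map' x := by
    refine UniformSpace.Completion.induction_on x
      (isClosed_eq (T.toContinuousLinearMap.completion.continuous.norm) continuous_norm) fun a => ?_
    change ‖UniformSpace.Completion.map T (a : UniformSpace.Completion V)‖ = _
    rw [UniformSpace.Completion.map_coe T.isometry.uniformContinuous]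
    simp

theorem LinearIsometry.completionMap_coe {V : Type*} [SeminormedAddCommGroup V]
    [InnerProductSpace ℝ V] (T : V →ₗᵢ[ℝ] V) (a : V) :
    T.completionMap (a : UniformSpace.Completion V) = (T a : V) :=
  UniformSpace.Completion.map_coe T.isometry.uniformContinuous a

variable [Field K]

theorem IsDoubleFolner.ultraMean_add_right (hF : IsDoubleFolner F) (hU : (U : Filter ℕ) ≤ atTop)
    (v : K) : ∀ f ∈ boundedFunctions K, ultraMean F U (f ∘ fun x => x + v) = ultraMean F U f := by
  intro f hf
  rcases eq_or_ne v 0 with rfl | hv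
  · simp only [add_zero]
    rfl
  · exact ultraMean_comp hU hf (add_left_injective v) (hF v hv).1

theorem IsDoubleFolner.ultraMean_mul_right (hF : IsDoubleFolner F) (hU : (U : Filter ℕ) ≤ atTop)
    {u : K} (hu : u ≠ 0) :
    ∀ f ∈ boundedFunctions K, ultraMean F U (f ∘ fun x => x * u) = ultraMean F U f :=
  fun _ hf => ultraMean_comp hU hf (mul_left_injective₀ hu) (hF u hu).2

theorem IsDoubleFolner.ultraMean_one (hF : IsDoubleFolner F) (hU : (U : Filter ℕ) ≤ atTop) :
    ultraMean F U 1 = 1 := by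
  refine ultraMean_eq (tendsto_const_nhds.congr' (hU ?_))
  -- The sets are eventually nonempty, since 0 / 0 = 0 stays away from the limit 1.
  filter_upwards [(hF 1 one_ne_zero).1.eventually_const_lt zero_lt_one] with N hN
  have h : ((F N).card : ℝ) ≠ 0 := by
    intro h
    rw [h, div_zero] at hN
    exact hN.false
  simp [finsetAverage, h]

open Classical in
/-- The isometries of the completed mean space induced by affine maps of the field. -/
noncomputable def IsDoubleFolner.affineIsometries (hF : IsDoubleFolner F)
    (hU : (U : Filter ℕ) ≤ atTop) :
    AffineIsometries K (UniformSpace.Completion (MeanSpace F U)) where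
  A v := (MeanSpace.compIsometry _ (hF.ultraMean_add_right hU v)).completionMap
  M u := if hu : u ≠ 0 then (MeanSpace.compIsometry _ (hF.ultraMean_mul_right hU hu)).completionMap
    else LinearIsometry.id
  A_zero x := by
    refine UniformSpace.Completion.induction_on x
      (isClosed_eq (LinearIsometry.continuous _) continuous_id) fun f => ?_
    rw [LinearIsometry.completionMap_coe]
    congr 1
    refine MeanSpace.ext (funext fun y => ?_)
    simp [MeanSpace.toFun_compIsometry]
  A_add v w x := by
    refine UniformSpace.Completion.induction_on x
      (isClosed_eq (LinearIsometry.continuous _)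
        ((LinearIsometry.continuous _).comp (LinearIsometry.continuous _))) fun f => ?_
    simp only [LinearIsometry.completionMap_coe]
    congr 1
    refine MeanSpace.ext (funext fun y => ?_)
    simp [MeanSpace.toFun_compIsometry, add_assoc]
  M_one x := by
    rw [dif_pos one_ne_zero]
    refine UniformSpace.Completion.induction_on x
      (isClosed_eq (LinearIsometry.continuous _) continuous_id) fun f => ?_
    rw [LinearIsometry.completionMap_coe]
    congr 1
    refine MeanSpace.ext (funext fun y => ?_)
    simp [MeanSpace.toFun_compIsometry]
  M_mul u w hu hw x := by
    rw [dif_pos hu, dif_pos hw, dif_pos (mul_ne_zero hu hw)]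
    refine UniformSpace.Completion.induction_on x
      (isClosed_eq (LinearIsometry.continuous _)
        ((LinearIsometry.continuous _).comp (LinearIsometry.continuous _))) fun f => ?_
    simp only [LinearIsometry.completionMap_coe]
    congr 1
    refine MeanSpace.ext (funext fun y => ?_)
    simp [MeanSpace.toFun_compIsometry, mul_assoc]
  A_M v u hu x := by
    rw [dif_pos hu]
    refine UniformSpace.Completion.induction_on x
      (isClosed_eq ((LinearIsometry.continuous _).comp (LinearIsometry.continuous _))
        ((LinearIsometry.continuous _).comp (LinearIsometry.continuous _))) fun f => ?_
    simp only [LinearIsometry.completionMap_coe]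
    congr 1
    refine MeanSpace.ext (funext fun y => ?_)
    simp [MeanSpace.toFun_compIsometry, add_mul, mul_comm u v]

/-- Along double central ultrafilters, the mean of `(E - u) ∩ E / u` asymptotically exceeds the
square of the mean of `E`. -/
theorem IsDoubleFolner.eventually_lt_ultraMean (hF : IsDoubleFolner F)
    (hU : (U : Filter ℕ) ≤ atTop) {R : Subring K} (hR : IsLID R) {p : Ultrafilter R}
    (hp : p ∈ doubleCentralUltrafilters R) (E : Set K) {ε : ℝ} (hε : 0 < ε) :
    ∀ᶠ u : R in (p : Filter R), ultraMean F U (E.indicator 1) ^ 2 - ε <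
      ultraMean F U (({x : K | x + (u : K) ∈ E} ∩ {x : K | (u : K) * x ∈ E}).indicator 1) := by
  let e : MeanSpace F U := ⟨E.indicator 1, indicator_one_mem_boundedFunctions E⟩
  let o : MeanSpace F U := ⟨1, 1, fun x => by simp⟩
  let ρ := hF.affineIsometries hU
  have hM : ∀ {u : K} (hu : u ≠ 0) (f : MeanSpace F U), ρ.M u f =
      ((MeanSpace.compIsometry _ (hF.ultraMean_mul_right hU hu) f : MeanSpace F U) :
        UniformSpace.Completion (MeanSpace F U)) := by
    intro u hu f
    rw [show ρ.M u = _ from dif_pos hu, LinearIsometry.completionMap_coe]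
  have hA : ∀ (v : K) (f : MeanSpace F U), ρ.A v f =
      ((MeanSpace.compIsometry _ (hF.ultraMean_add_right hU v) f : MeanSpace F U) :
        UniformSpace.Completion (MeanSpace F U)) := fun v f =>
    LinearIsometry.completionMap_coe _ f
  have ho : ‖(o : UniformSpace.Completion (MeanSpace F U))‖ = 1 := by
    rw [← sq_eq_sq₀ (norm_nonneg _) zero_le_one, ← real_inner_self_eq_norm_sq,
      UniformSpace.Completion.inner_coe, one_pow, MeanSpace.inner_def, ← hF.ultraMean_one hU]
    congr 1
    exact mul_one _
  have heo : inner ℝ (e : UniformSpace.Completion (MeanSpace F U)) o =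
      ultraMean F U (E.indicator 1) := by
    rw [UniformSpace.Completion.inner_coe, MeanSpace.inner_def]
    congr 1
    exact mul_one _
  have hmain := ρ.eventually_sq_inner_sub_lt hR hp ho (fun v => hA v o) (fun u hu => hM hu o) e hε
  filter_upwards [hmain, hp.2.1.compl_singleton_mem 0] with u hu hu0
  rw [heo, hA, hM (by simpa using hu0), UniformSpace.Completion.inner_coe,
    MeanSpace.inner_def] at hu
  convert hu using 2
  ext x
  rw [Set.inter_indicator_one]
  change _ = E.indicator (1 : K → ℝ) (x + (u : K)) * E.indicator (1 : K → ℝ) (x * (u : K))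
  rw [mul_comm x]
  rfl

end Means

theorem mainTheorem4 {K : Type*} [Field K] [Countable K] (R : Subring K) (hR : IsLID R)
    (F : ℕ → Finset K) (hF : IsDoubleFolner F) (E : Set K) (hE : 0 < folnerUpperDensity F E)
    (ε : ℝ) (hε : 0 < ε) :
    IsDCStar {u : R | u ≠ 0 ∧
      folnerUpperDensity F ({x : K | x + (u : K) ∈ E} ∩ {x : K | (u : K) * x ∈ E}) >
        folnerUpperDensity F E ^ 2 - ε} ∧
    IsAffinelySyndetic {u : R | u ≠ 0 ∧
      folnerUpperDensity F ({x : K | x + (u : K) ∈ E} ∩ {x : K | (u : K) * x ∈ E}) >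
        folnerUpperDensity F E ^ 2 - ε} := by
  suffices h : IsDCStar {u : R | u ≠ 0 ∧
      folnerUpperDensity F ({x : K | x + (u : K) ∈ E} ∩ {x : K | (u : K) * x ∈ E}) >
        folnerUpperDensity F E ^ 2 - ε} from ⟨h, hR.isAffinelySyndetic_of_isDCStar h⟩
  rintro D ⟨p, hp, hD⟩
  -- Equality is needed for E alone; for the intersections the mean need only bound the density from
  -- below.
  obtain ⟨U, hU, hUE⟩ := exists_ultraMean_indicator_eq F E
  have h := hF.eventually_lt_ultraMean hU hR hp E hε
  refine p.nonempty_of_mem (Filter.inter_mem ?_ hD)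
  filter_upwards [h, hp.2.1.compl_singleton_mem 0] with u hu hu0
  rw [hUE] at hu
  exact ⟨hu0, hu.trans_le (ultraMean_indicator_le hU _)⟩
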